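/- Let $h_0(t)=2^{1/4}e^{-\pi t^2}$ be the normalized Gaussian on $\mathbb{R}$, and for $j\ge 0$ let $h_j(t)=c_j\,e^{\pi t^2}\frac{d^j}{dt^j}\big(e^{-2\pi t^2}\big)$ be the $j$-th Hermite function, where the real constant $c_j$, of sign $(-1)^j$, is chosen so that $\|h_j\|_{L^2(\mathbb{R})}=1$. For functions $f,g:\mathbb{R}\to\mathbb{C}$ with $f,g\in L^2(\mathbb{R})$, the short-time Fourier transform of $f$ with window $g$ is $$V_gf(x,\xi)=\int_{\mathbb{R}} f(t)\,\overline{g(t-x)}\,e^{-2\pi i\xi t}\,dt,\qquad (x,\xi)\in\mathbb{R}^2.$$ (i) Let $p,q$ be polynomials with complex coefficients, and let $g=p\,h_0$ and $f=q\,h_0$. If $V_gf(x,\xi)\neq 0$ for all $(x,\xi)\in\mathbb{R}^2$, then $\deg p=\deg q$. (ii) In other words, if $f=\sum_{j=0}^{M}a_jh_j$ and $g=\sum_{j=0}^{N}b_jh_j$ with complex coefficients, $a_M\neq 0$, $b_N\neq 0$ and $M\neq N$, then there is $(x,\xi)\in\mathbb{R}^2$ with $V_gf(x,\xi)=0$.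 -/

import Mathlib

open MeasureTheory Polynomial

noncomputable section

namespace HermiteSTFT

/-- The short-time Fourier transform of `f` with window `g` on the real line,
`V_g f (x, ξ) = ∫ f(t) * conj (g (t - x)) * exp (-2 π i ξ t) dt`. -/
def stft (g f : ℝ → ℂ) (x ξ : ℝ) : ℂ :=
  ∫ t : ℝ, f t * (starRingEnd ℂ) (g (t - x)) *
    Complex.exp (-2 * (Real.pi : ℂ) * Complex.I * (ξ : ℂ) * (t : ℂ))

/-- The normalized Gaussian `h₀(t) = 2^{1/4} exp (-π t²)`. -/
def gaussian (t : ℝ) : ℝ :=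
  (2 : ℝ) ^ (1 / 4 : ℝ) * Real.exp (-Real.pi * t ^ 2)

/-- The function `p h₀` on the real line, for a polynomial `p` with complex coefficients. -/
def polyGaussian (p : ℂ[X]) (t : ℝ) : ℂ :=
  p.eval (t : ℂ) * (gaussian t : ℂ)

/-- The unnormalized Hermite function `exp (π t²) * (d/dt)^j exp (-2 π t²)`. -/
def rawHermite (j : ℕ) (t : ℝ) : ℝ :=
  Real.exp (Real.pi * t ^ 2) *
    iteratedDeriv j (fun s : ℝ => Real.exp (-2 * Real.pi * s ^ 2)) t

/-- The `j`-th Hermite function: `rawHermite j` divided by its `L²` norm, with the usual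
sign `(-1)^j` that makes the leading coefficient of its polynomial factor positive. -/
def hermiteFun (j : ℕ) (t : ℝ) : ℝ :=
  (-1) ^ j / Real.sqrt (∫ s : ℝ, rawHermite j s ^ 2) * rawHermite j t

/-- The Hermite expansion `∑_{j ≤ N} c_j h_j`. -/
def hermiteSum (N : ℕ) (c : ℕ → ℂ) (t : ℝ) : ℂ :=
  ∑ j ∈ Finset.range (N + 1), c j * (hermiteFun j t : ℂ)

end HermiteSTFT

end

open Filter Asymptotics Bornology
open scoped FourierTransform

namespace HermiteSTFT

/-! Part (i) is a winding number argument. Put `z = x + iξ`. After the shift `t = s + x/2`, the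
transform is a nowhere zero factor times a polynomial in `x, ξ` (`stft_polyGaussian_eq`). The
Fourier integral of `s^k` against `exp (-2πs²)` has leading term a constant times `(-iξ/2)^k`. To
top order `s` thus becomes `-iξ/2`, so `s + x/2` becomes `conj z / 2` and `s - x/2` becomes `-z/2`.
Hence the polynomial is asymptotic to a nonzero multiple of `conj z ^ deg q * z ^ deg p`
(`stftFactor_isLittleO`), whose winding number on large circles is `deg p - deg q`. A zero-free
continuous function on the plane has a continuous logarithm, hence winding number zero
(`eq_of_isLittleO_sub_monomial`). Part (ii) is part (i) for Hermite sums, since `h_j` is `h₀` times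
a polynomial of exact degree `j`. -/

/-! ### Winding numbers via continuous logarithms -/

theorem exists_continuous_log {F : ℂ → ℂ} (hF : Continuous F) (h0 : ∀ z, F z ≠ 0) :
    ∃ L : ℂ → ℂ, Continuous L ∧ ∀ z, Complex.exp (L z) = F z := by
  -- The plane is simply connected, so `F` lifts through the covering `exp : ℂ → ℂ \ {0}`.
  obtain ⟨L, ⟨-, hL⟩, -⟩ := Complex.isCoveringMap_exp.existsUnique_continuousMap_lifts
    (⟨fun z => ⟨F z, h0 z⟩, by fun_prop⟩ : C(ℂ, {z : ℂ // z ≠ 0})) (a₀ := 0)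
    (e₀ := Complex.log (F 0)) (Subtype.ext (Complex.exp_log (h0 0)))
  exact ⟨L, L.continuous, fun z => congrArg Subtype.val (congrFun hL z)⟩

theorem eq_of_exp_eq_const {D : ℝ → ℂ} (hD : Continuous D) {w : ℂ}
    (h : ∀ θ, Complex.exp (D θ) = w) (a b : ℝ) : D a = D b := by
  have := Complex.isCoveringMap_exp.eq_of_comp_eq hD (continuous_const (y := D b))
    (by ext θ; simp [h]) b rfl
  exact congrFun this a

/-- A nowhere vanishing continuous function on the plane cannot be asymptotic to
`c * conj z ^ M * z ^ N` with `M ≠ N`. -/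
theorem eq_of_isLittleO_sub_monomial {F : ℂ → ℂ} (hF : Continuous F) (h0 : ∀ z, F z ≠ 0)
    {c : ℂ} (hc : c ≠ 0) {M N : ℕ}
    (h : (fun z => F z - c * ((starRingEnd ℂ) z ^ M * z ^ N)) =o[cobounded ℂ]
      fun z => ‖z‖ ^ (M + N)) : M = N := by
  obtain ⟨L, hLc, hL⟩ := exists_continuous_log hF h0
  have hev := h.def (c := ‖c‖ / 2) (by positivity)
  obtain ⟨R, hR0, hR⟩ : ∃ R : ℝ, 0 < R ∧ ∀ z : ℂ, ‖z‖ = R →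
      ‖F z - c * ((starRingEnd ℂ) z ^ M * z ^ N)‖ ≤ ‖c‖ / 2 * ‖z‖ ^ (M + N) := by
    rw [← comap_norm_atTop, eventually_comap, eventually_atTop] at hev
    obtain ⟨R, hR⟩ := hev
    refine ⟨max R 1, by positivity, fun z hz => ?_⟩
    simpa using hR _ (le_max_left _ _) z hz
  set γ : ℝ → ℂ := fun θ => R * Complex.exp (θ * Complex.I) with hγ
  have hγc : Continuous γ := by fun_prop
  have hγn (θ : ℝ) : ‖γ θ‖ = R := by
    simp [hγ, Complex.norm_exp_ofReal_mul_I, abs_of_pos hR0]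
  set G : ℝ → ℂ := fun θ => c * ((starRingEnd ℂ) (γ θ) ^ M * γ θ ^ N) with hG
  have hGc : Continuous G := by
    have := Complex.continuous_conj.comp hγc
    simp only [Function.comp_def] at this
    fun_prop
  have hGn (θ : ℝ) : ‖G θ‖ = ‖c‖ * R ^ (M + N) := by
    simp [hG, hγn, pow_add]
  have hG0 (θ : ℝ) : G θ ≠ 0 := by
    rw [← norm_pos_iff, hGn]; positivity
  have hGe (θ : ℝ) : G θ = c * R ^ (M + N) * Complex.exp (((N : ℂ) - M) * θ * Complex.I) := by
    have h1 : (starRingEnd ℂ) (γ θ) = R * Complex.exp (-(θ * Complex.I)) := by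
      simp [hγ, ← Complex.exp_conj]
    simp only [hG, h1]
    simp only [hγ, mul_pow, ← Complex.exp_nat_mul]
    rw [show ((N : ℂ) - M) * θ * Complex.I
      = M * -(θ * Complex.I) + N * (θ * Complex.I) by ring, Complex.exp_add]
    ring
  -- The quotient stays within distance 1 of 1, so its principal logarithm is continuous along the
  -- circle.
  have hu (θ : ℝ) : F (γ θ) / G θ ∈ Complex.slitPlane := by
    have hlt : ‖F (γ θ) / G θ - 1‖ < 1 := by
      rw [div_sub_one (hG0 θ), norm_div, div_lt_one (norm_pos_iff.2 (hG0 θ)), hGn]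
      refine (hR _ (hγn θ)).trans_lt ?_
      rw [hγn]
      have : 0 < ‖c‖ * R ^ (M + N) := by positivity
      linarith
    simpa using Complex.mem_slitPlane_of_norm_lt_one hlt
  -- `exp ∘ D` is constant, hence so is `D`. The first two terms are `2π`-periodic, so the linear
  -- term must vanish over a full turn.
  set D : ℝ → ℂ := fun θ =>
    L (γ θ) - Complex.log (F (γ θ) / G θ) - ((N : ℂ) - M) * θ * Complex.I with hD
  have hDc : Continuous D := by
    have h1 : Continuous fun θ => Complex.log (F (γ θ) / G θ) :=
      Continuous.clog ((hF.comp hγc).div hGc hG0) hu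
    have h2 := hLc.comp hγc
    simp only [Function.comp_def] at h2
    fun_prop
  have hDe (θ : ℝ) : Complex.exp (D θ) = c * R ^ (M + N) := by
    simp only [hD]
    rw [Complex.exp_sub, Complex.exp_sub, hL,
      Complex.exp_log (div_ne_zero (h0 _) (hG0 θ)), div_div_cancel₀ (h0 _), hGe,
      mul_div_cancel_right₀ _ (Complex.exp_ne_zero _)]
  have key := eq_of_exp_eq_const hDc hDe (2 * Real.pi) 0
  have hγp : γ (2 * Real.pi) = γ 0 := by
    simp [hγ]
  have hGp : G (2 * Real.pi) = G 0 := by simp only [hG, hγp]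
  simp only [hD, hγp, hGp] at key
  have hpi : (Real.pi : ℂ) ≠ 0 := by exact_mod_cast Real.pi_ne_zero
  have : ((N : ℂ) - M) * (2 * Real.pi * Complex.I) = 0 := by
    push_cast at key
    linear_combination -key
  have h3 := (mul_eq_zero.1 this).resolve_right (by simp [hpi])
  exact_mod_cast (sub_eq_zero.1 h3).symm

/-! ### Derivatives of Gaussians -/

/-- The polynomial factor of the `j`-th derivative of `exp (-a s ^ 2)`. -/
noncomputable def gaussPoly (a : ℝ) : ℕ → ℝ[X]
  | 0 => 1
  | j + 1 => derivative (gaussPoly a j) - C (2 * a) * X * gaussPoly a j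

theorem gaussPoly_degree_coeff (a : ℝ) (j : ℕ) :
    (gaussPoly a j).natDegree ≤ j ∧ (gaussPoly a j).coeff j = (-(2 * a)) ^ j := by
  induction j with
  | zero => simp [gaussPoly]
  | succ j ih =>
    obtain ⟨h1, h2⟩ := ih
    have h3 : (derivative (gaussPoly a j)).natDegree ≤ j :=
      (natDegree_derivative_le _).trans (by omega)
    constructor
    · refine (natDegree_sub_le _ _).trans (max_le (by omega) ?_)
      refine natDegree_mul_le.trans ?_
      have : (C (2 * a) * X : ℝ[X]).natDegree ≤ 1 := by
        simpa using natDegree_C_mul_X_pow_le (2 * a) 1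
      omega
    · rw [gaussPoly, coeff_sub, coeff_eq_zero_of_natDegree_lt (by omega), mul_assoc, coeff_C_mul,
        coeff_X_mul, h2]
      ring

theorem hasDerivAt_gaussPoly (a : ℝ) (j : ℕ) (s : ℝ) :
    HasDerivAt (fun s => (gaussPoly a j).eval s * Real.exp (-a * s ^ 2))
      ((gaussPoly a (j + 1)).eval s * Real.exp (-a * s ^ 2)) s := by
  have h1 : HasDerivAt (fun s : ℝ => Real.exp (-a * s ^ 2))
      (Real.exp (-a * s ^ 2) * (-a * (2 * s))) s := by
    simpa using ((hasDerivAt_pow 2 s).const_mul (-a)).exp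
  refine (((gaussPoly a j).hasDerivAt s).mul h1).congr_deriv ?_
  simp [gaussPoly]
  ring

theorem iteratedDeriv_gaussian (a : ℝ) (j : ℕ) :
    iteratedDeriv j (fun s : ℝ => Real.exp (-a * s ^ 2)) =
      fun s => (gaussPoly a j).eval s * Real.exp (-a * s ^ 2) := by
  induction j with
  | zero => simp [gaussPoly]
  | succ j ih =>
    rw [iteratedDeriv_succ, ih]
    exact funext fun s => (hasDerivAt_gaussPoly a j s).deriv

theorem iteratedDeriv_ofReal_gaussian (a : ℝ) (j : ℕ) :
    iteratedDeriv j (fun s : ℝ => (Real.exp (-a * s ^ 2) : ℂ)) =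
      fun s => (((gaussPoly a j).eval s * Real.exp (-a * s ^ 2) : ℝ) : ℂ) := by
  induction j with
  | zero => simp [gaussPoly]
  | succ j ih =>
    rw [iteratedDeriv_succ, ih]
    exact funext fun s => (hasDerivAt_gaussPoly a j s).ofReal_comp.deriv

/-! ### Fourier transforms of Gaussian moments -/

theorem integrable_pow_mul_gaussian {a : ℝ} (ha : 0 < a) (k : ℕ) :
    Integrable fun s : ℝ => s ^ k * Real.exp (-a * s ^ 2) := by
  simpa using integrable_rpow_mul_exp_neg_mul_sq ha (s := k) (by
    have : (0 : ℝ) ≤ k := k.cast_nonneg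
    linarith)

theorem integrable_moment (ξ : ℝ) (k : ℕ) :
    Integrable fun s : ℝ => (s : ℂ) ^ k * ((Real.exp (-(2 * Real.pi) * s ^ 2) : ℂ) *
      Complex.exp (-2 * Real.pi * Complex.I * ξ * s)) := by
  have h := (integrable_pow_mul_gaussian (a := 2 * Real.pi) (by positivity) k).ofReal (𝕜 := ℂ)
  refine h.mono (by fun_prop) (Eventually.of_forall fun s => le_of_eq ?_)
  have : ‖Complex.exp (-2 * Real.pi * Complex.I * ξ * s)‖ = 1 := by
    rw [show -2 * (Real.pi : ℂ) * Complex.I * ξ * s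
      = ((-2 * Real.pi * ξ * s : ℝ) : ℂ) * Complex.I by push_cast; ring]
    exact Complex.norm_exp_ofReal_mul_I _
  simp only [norm_mul, this]
  simp

/-- The polynomial factor of the Fourier transform of `s ^ k * exp (-2 π s ^ 2)`. -/
noncomputable def momentPoly (k : ℕ) : ℂ[X] :=
  C (1 / (2 : ℂ) ^ (1 / 2 : ℂ) * ((-2 * Real.pi * Complex.I) ^ k)⁻¹) *
    (gaussPoly (Real.pi / 2) k).map (algebraMap ℝ ℂ)

theorem neg_two_pi_I_ne_zero : (-2 * Real.pi * Complex.I : ℂ) ≠ 0 := by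
  simp [Real.pi_ne_zero]

/-- Multiplication by `(-2πis)^k` becomes the `k`-th derivative of the transform, and `exp (-2πs²)`
has transform `2^(-1/2) exp (-πξ²/2)`. -/
theorem integral_moment (ξ : ℝ) (k : ℕ) :
    ∫ s : ℝ, (s : ℂ) ^ k * ((Real.exp (-(2 * Real.pi) * s ^ 2) : ℂ) *
      Complex.exp (-2 * Real.pi * Complex.I * ξ * s)) =
    (momentPoly k).eval (ξ : ℂ) * Real.exp (-(Real.pi / 2) * ξ ^ 2) := by
  have h1 := Real.iteratedDeriv_fourier (N := ⊤) (n := k)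
    (f := fun s : ℝ => (Real.exp (-(2 * Real.pi) * s ^ 2) : ℂ)) (fun n _ => by
      have h := (integrable_pow_mul_gaussian (a := 2 * Real.pi) (by positivity) n).ofReal (𝕜 := ℂ)
      refine h.congr (Eventually.of_forall fun s => ?_)
      simp) le_top
  have h2 : 𝓕 (fun s : ℝ => (Real.exp (-(2 * Real.pi) * s ^ 2) : ℂ)) =
      fun t : ℝ => 1 / (2 : ℂ) ^ (1 / 2 : ℂ) * (Real.exp (-(Real.pi / 2) * t ^ 2) : ℂ) := by
    have := fourier_gaussian_pi (b := 2) (by simp)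
    convert this using 2
    · ext s; push_cast; congr 1; ring
    · push_cast; congr 2; ring
  rw [h2] at h1
  have h3 := congrFun h1 ξ
  rw [iteratedDeriv_const_mul_field, iteratedDeriv_ofReal_gaussian,
    Real.fourier_real_eq_integral_exp_smul] at h3
  have h4 : ∫ v : ℝ, Complex.exp (↑(-2 * Real.pi * v * ξ) * Complex.I) •
      (-2 * Real.pi * Complex.I * v) ^ k • ((Real.exp (-(2 * Real.pi) * v ^ 2) : ℝ) : ℂ) =
      (-2 * Real.pi * Complex.I) ^ k * ∫ s : ℝ, (s : ℂ) ^ k *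
        ((Real.exp (-(2 * Real.pi) * s ^ 2) : ℂ) *
          Complex.exp (-2 * Real.pi * Complex.I * ξ * s)) := by
    rw [← integral_const_mul]
    congr 1 with v
    rw [show ((-2 * Real.pi * v * ξ : ℝ) : ℂ) * Complex.I = -2 * Real.pi * Complex.I * ξ * v by
      push_cast; ring]
    simp only [smul_eq_mul, mul_pow]
    ring
  rw [h4] at h3
  have h5 := pow_ne_zero k neg_two_pi_I_ne_zero
  rw [← mul_right_inj' h5, ← h3, momentPoly, eval_mul, eval_C, eval_map_algebraMap]
  have h6 : (aeval (ξ : ℂ)) (gaussPoly (Real.pi / 2) k)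
      = (((gaussPoly (Real.pi / 2) k).eval ξ : ℝ) : ℂ) := by
    simpa using (aeval_algebraMap_apply ℂ ξ (gaussPoly (Real.pi / 2) k))
  rw [h6]
  push_cast
  field_simp

/-! ### Leading terms at infinity -/

theorem isBigO_re (n : ℕ) :
    (fun z : ℂ => (z.re : ℂ) ^ n) =O[cobounded ℂ] fun z => ‖z‖ ^ n :=
  .of_norm_le fun z => by
    simpa using pow_le_pow_left₀ (abs_nonneg _) (Complex.abs_re_le_norm z) n

theorem isBigO_im (n : ℕ) :
    (fun z : ℂ => (z.im : ℂ) ^ n) =O[cobounded ℂ] fun z => ‖z‖ ^ n :=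
  .of_norm_le fun z => by
    simpa using pow_le_pow_left₀ (abs_nonneg _) (Complex.abs_im_le_norm z) n

theorem isLittleO_norm_pow {m n : ℕ} (h : m < n) :
    (fun z : ℂ => ‖z‖ ^ m) =o[cobounded ℂ] fun z => ‖z‖ ^ n :=
  (isLittleO_pow_pow_atTop_of_lt h).comp_tendsto tendsto_norm_cobounded_atTop

theorem momentPoly_isLittleO (k : ℕ) :
    (fun z : ℂ => (momentPoly k).eval (z.im : ℂ) -
      1 / (2 : ℂ) ^ (1 / 2 : ℂ) * (-Complex.I * z.im / 2) ^ k) =o[cobounded ℂ]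
      fun z => ‖z‖ ^ k := by
  have hd : (momentPoly k).natDegree < k + 1 := by
    refine Nat.lt_succ_of_le ((natDegree_C_mul_le _ _).trans ?_)
    exact natDegree_map_le.trans (gaussPoly_degree_coeff _ _).1
  have hc : (momentPoly k).coeff k = 1 / (2 : ℂ) ^ (1 / 2 : ℂ) * (-Complex.I / 2) ^ k := by
    rw [momentPoly, coeff_C_mul, coeff_map, (gaussPoly_degree_coeff _ _).2, mul_assoc,
      map_pow, ← inv_pow, ← mul_pow]
    congr 2
    -- What remains is `(-2πi)⁻¹ * (-π) = -i/2`.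
    have hpi : (Real.pi : ℂ) ≠ 0 := by exact_mod_cast Real.pi_ne_zero
    simp
    field_simp
  have he (z : ℂ) : (momentPoly k).eval (z.im : ℂ) -
      1 / (2 : ℂ) ^ (1 / 2 : ℂ) * (-Complex.I * z.im / 2) ^ k =
      ∑ i ∈ Finset.range k, (momentPoly k).coeff i * (z.im : ℂ) ^ i := by
    rw [eval_eq_sum_range' hd, Finset.sum_range_succ, hc]
    ring
  simp only [he]
  apply IsLittleO.fun_sum
  intro i hi
  refine ((isBigO_im i).const_mul_left _).trans_isLittleO ?_
  exact isLittleO_norm_pow (Finset.mem_range.1 hi)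

/-- The Gaussian Fourier integral of `(s + x / 2) ^ i * (s - x / 2) ^ j`, stripped of its Gaussian
factor and written in terms of `z = x + i ξ`. -/
noncomputable def bimonomial (i j : ℕ) (z : ℂ) : ℂ :=
  ∑ a ∈ Finset.range (i + 1), ∑ b ∈ Finset.range (j + 1),
    (i.choose a * (z.re / 2) ^ (i - a)) * (j.choose b * (-(z.re / 2)) ^ (j - b)) *
      (momentPoly (a + b)).eval (z.im : ℂ)

theorem continuous_bimonomial (i j : ℕ) : Continuous (bimonomial i j) := by
  unfold bimonomial
  fun_prop

/-- Replacing each moment by its leading term lets the double binomial sum factor again, with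
`-iξ/2` in place of `s`. -/
theorem bimonomial_isLittleO (i j : ℕ) :
    (fun z => bimonomial i j z - 1 / (2 : ℂ) ^ (1 / 2 : ℂ) *
      (((starRingEnd ℂ) z / 2) ^ i * (-z / 2) ^ j)) =o[cobounded ℂ] fun z => ‖z‖ ^ (i + j) := by
  have he (z : ℂ) : bimonomial i j z - 1 / (2 : ℂ) ^ (1 / 2 : ℂ) *
      (((starRingEnd ℂ) z / 2) ^ i * (-z / 2) ^ j) =
      ∑ a ∈ Finset.range (i + 1), ∑ b ∈ Finset.range (j + 1),
        (i.choose a * (z.re / 2) ^ (i - a)) * (j.choose b * (-(z.re / 2)) ^ (j - b)) *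
        ((momentPoly (a + b)).eval (z.im : ℂ) -
          1 / (2 : ℂ) ^ (1 / 2 : ℂ) * (-Complex.I * z.im / 2) ^ (a + b)) := by
    have h1 : (starRingEnd ℂ) z / 2 = -Complex.I * z.im / 2 + z.re / 2 := by
      apply Complex.ext <;> simp
    have h2 : -z / 2 = -Complex.I * z.im / 2 + -(z.re / 2) := by
      apply Complex.ext <;> simp [neg_div]
    rw [h1, h2, add_pow, add_pow, Finset.sum_mul_sum, Finset.mul_sum, bimonomial,
      ← Finset.sum_sub_distrib]
    refine Finset.sum_congr rfl fun a _ => ?_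
    rw [Finset.mul_sum, ← Finset.sum_sub_distrib]
    refine Finset.sum_congr rfl fun b _ => ?_
    rw [pow_add]
    ring
  simp only [he]
  apply IsLittleO.fun_sum
  intro a ha
  apply IsLittleO.fun_sum
  intro b hb
  have hx (n : ℕ) (e c : ℂ) : (fun z : ℂ => e * (c * z.re) ^ n) =O[cobounded ℂ]
      fun z => ‖z‖ ^ n := by
    simp only [mul_pow]
    exact ((isBigO_re n).const_mul_left _).const_mul_left _
  have h := ((hx (i - a) (i.choose a) (1 / 2)).mul
    (hx (j - b) (j.choose b) (-1 / 2))).mul_isLittleO (momentPoly_isLittleO (a + b))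
  have ha' := Finset.mem_range.1 ha
  have hb' := Finset.mem_range.1 hb
  refine (h.congr_left fun z => ?_).congr_right fun z => ?_
  · rw [show (1 / 2 : ℂ) * z.re = z.re / 2 by ring, show (-1 / 2 : ℂ) * z.re = -(z.re / 2) by ring]
  · rw [← pow_add, ← pow_add]
    congr 1
    omega

theorem bimonomial_kernel_eq (i j : ℕ) (x ξ s : ℝ) :
    ((s : ℂ) + x / 2) ^ i * ((s : ℂ) - x / 2) ^ j * ((Real.exp (-(2 * Real.pi) * s ^ 2) : ℂ) *
      Complex.exp (-2 * Real.pi * Complex.I * ξ * s)) =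
    ∑ a ∈ Finset.range (i + 1), ∑ b ∈ Finset.range (j + 1),
      (i.choose a * (x / 2) ^ (i - a)) * (j.choose b * (-(x / 2)) ^ (j - b)) *
      ((s : ℂ) ^ (a + b) * ((Real.exp (-(2 * Real.pi) * s ^ 2) : ℂ) *
        Complex.exp (-2 * Real.pi * Complex.I * ξ * s))) := by
  rw [sub_eq_add_neg, add_pow, add_pow, Finset.sum_mul_sum, Finset.sum_mul]
  refine Finset.sum_congr rfl fun a _ => ?_
  rw [Finset.sum_mul]
  refine Finset.sum_congr rfl fun b _ => ?_
  rw [pow_add]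
  ring

theorem integrable_bimonomial (i j : ℕ) (x ξ : ℝ) :
    Integrable fun s : ℝ => ((s : ℂ) + x / 2) ^ i * ((s : ℂ) - x / 2) ^ j *
      ((Real.exp (-(2 * Real.pi) * s ^ 2) : ℂ) *
        Complex.exp (-2 * Real.pi * Complex.I * ξ * s)) := by
  simp only [bimonomial_kernel_eq]
  exact integrable_finsetSum _ fun a _ => integrable_finsetSum _ fun b _ =>
    (integrable_moment ξ (a + b)).const_mul _

theorem integral_bimonomial (i j : ℕ) (x ξ : ℝ) :
    ∫ s : ℝ, ((s : ℂ) + x / 2) ^ i * ((s : ℂ) - x / 2) ^ j *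
      ((Real.exp (-(2 * Real.pi) * s ^ 2) : ℂ) *
        Complex.exp (-2 * Real.pi * Complex.I * ξ * s)) =
    bimonomial i j ⟨x, ξ⟩ * Real.exp (-(Real.pi / 2) * ξ ^ 2) := by
  simp only [bimonomial_kernel_eq]
  rw [integral_finsetSum _ fun a _ => integrable_finsetSum _ fun b _ =>
    (integrable_moment ξ (a + b)).const_mul _, bimonomial, Finset.sum_mul]
  refine Finset.sum_congr rfl fun a _ => ?_
  rw [integral_finsetSum _ fun b _ => (integrable_moment ξ (a + b)).const_mul _, Finset.sum_mul]
  refine Finset.sum_congr rfl fun b _ => ?_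
  rw [integral_const_mul, integral_moment]
  ring

/-! ### The transform of polynomials times Gaussians -/

/-- The non-Gaussian factor of the short-time Fourier transform of `q h₀` with window `p h₀`. -/
noncomputable def stftFactor (p q : ℂ[X]) (z : ℂ) : ℂ :=
  ∑ i ∈ Finset.range (q.natDegree + 1), ∑ j ∈ Finset.range (p.natDegree + 1),
    q.coeff i * (starRingEnd ℂ) (p.coeff j) * bimonomial i j z

theorem continuous_stftFactor (p q : ℂ[X]) : Continuous (stftFactor p q) := by
  unfold stftFactor
  have := continuous_bimonomial
  fun_prop

theorem stftFactor_isLittleO (p q : ℂ[X]) :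
    (fun z => stftFactor p q z - q.leadingCoeff * (starRingEnd ℂ) p.leadingCoeff *
      (1 / (2 : ℂ) ^ (1 / 2 : ℂ) * (1 / 2) ^ q.natDegree * (-1 / 2) ^ p.natDegree) *
        ((starRingEnd ℂ) z ^ q.natDegree * z ^ p.natDegree)) =o[cobounded ℂ]
      fun z => ‖z‖ ^ (q.natDegree + p.natDegree) := by
  have hO (i j : ℕ) : bimonomial i j =O[cobounded ℂ] fun z => ‖z‖ ^ (i + j) := by
    have h1 : (fun z : ℂ => 1 / (2 : ℂ) ^ (1 / 2 : ℂ) *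
      (((starRingEnd ℂ) z / 2) ^ i * (-z / 2) ^ j)) =O[cobounded ℂ] fun z => ‖z‖ ^ (i + j) := by
      refine IsBigO.const_mul_left (.of_norm_le fun z => ?_) _
      simp only [norm_mul, norm_pow, norm_div, norm_neg, RCLike.norm_conj, pow_add]
      have : ‖z‖ / ‖(2 : ℂ)‖ ≤ ‖z‖ := by
        simp
      gcongr
    exact ((bimonomial_isLittleO i j).isBigO.add h1).congr_left fun z => by ring
  have hlow {i j : ℕ} (h : i + j < q.natDegree + p.natDegree) (e : ℂ) :
      (fun z => e * bimonomial i j z) =o[cobounded ℂ]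
        fun z => ‖z‖ ^ (q.natDegree + p.natDegree) :=
    ((hO i j).const_mul_left e).trans_isLittleO (isLittleO_norm_pow h)
  have htop := (bimonomial_isLittleO q.natDegree p.natDegree).const_mul_left
    (q.leadingCoeff * (starRingEnd ℂ) p.leadingCoeff)
  have h1 : (fun z => ∑ i ∈ Finset.range q.natDegree, ∑ j ∈ Finset.range (p.natDegree + 1),
      q.coeff i * (starRingEnd ℂ) (p.coeff j) * bimonomial i j z) =o[cobounded ℂ]
        fun z => ‖z‖ ^ (q.natDegree + p.natDegree) := by
    apply IsLittleO.fun_sum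
    intro i hi
    apply IsLittleO.fun_sum
    intro j hj
    have := Finset.mem_range.1 hi
    have := Finset.mem_range.1 hj
    exact hlow (by omega) _
  have h2 : (fun z => ∑ j ∈ Finset.range p.natDegree,
      q.coeff q.natDegree * (starRingEnd ℂ) (p.coeff j) * bimonomial q.natDegree j z)
        =o[cobounded ℂ] fun z => ‖z‖ ^ (q.natDegree + p.natDegree) := by
    apply IsLittleO.fun_sum
    intro j hj
    have := Finset.mem_range.1 hj
    exact hlow (by omega) _
  refine ((h1.add h2).add htop).congr_left fun z => ?_
  rw [stftFactor, Finset.sum_range_succ _ q.natDegree, Finset.sum_range_succ _ p.natDegree]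
  simp only [coeff_natDegree]
  rw [show (starRingEnd ℂ) z / 2 = 1 / 2 * (starRingEnd ℂ) z by ring,
    show -z / 2 = -1 / 2 * z by ring, mul_pow, mul_pow]
  ring

/-- The shift `t = s + x/2` separates the variables: `(s + x/2)² + (s - x/2)² = 2s² + x²/2`. -/
theorem stft_polyGaussian_eq (p q : ℂ[X]) (x ξ : ℝ) :
    stft (polyGaussian p) (polyGaussian q) x ξ =
      (((2 : ℝ) ^ (1 / 4 : ℝ) * (2 : ℝ) ^ (1 / 4 : ℝ) * Real.exp (-Real.pi / 2 * x ^ 2) *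
        Real.exp (-(Real.pi / 2) * ξ ^ 2) : ℝ) : ℂ) *
        Complex.exp (-Real.pi * Complex.I * ξ * x) * stftFactor p q ⟨x, ξ⟩ := by
  set K : ℂ := (((2 : ℝ) ^ (1 / 4 : ℝ) * (2 : ℝ) ^ (1 / 4 : ℝ) *
    Real.exp (-Real.pi / 2 * x ^ 2) : ℝ) : ℂ) * Complex.exp (-Real.pi * Complex.I * ξ * x) with hK
  have hker (s : ℝ) : polyGaussian q (s + x / 2) *
      (starRingEnd ℂ) (polyGaussian p (s + x / 2 - x)) *
      Complex.exp (-2 * Real.pi * Complex.I * ξ * ((s + x / 2 : ℝ) : ℂ)) =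
      K * ∑ i ∈ Finset.range (q.natDegree + 1), ∑ j ∈ Finset.range (p.natDegree + 1),
        q.coeff i * (starRingEnd ℂ) (p.coeff j) *
        (((s : ℂ) + x / 2) ^ i * ((s : ℂ) - x / 2) ^ j *
          ((Real.exp (-(2 * Real.pi) * s ^ 2) : ℂ) *
            Complex.exp (-2 * Real.pi * Complex.I * ξ * s))) := by
    have hg : (gaussian (s + x / 2) : ℂ) * gaussian (s + x / 2 - x) *
        Complex.exp (-2 * Real.pi * Complex.I * ξ * ((s + x / 2 : ℝ) : ℂ)) =
        K * ((Real.exp (-(2 * Real.pi) * s ^ 2) : ℂ) *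
          Complex.exp (-2 * Real.pi * Complex.I * ξ * s)) := by
      have e1 : gaussian (s + x / 2) * gaussian (s + x / 2 - x) =
          (2 : ℝ) ^ (1 / 4 : ℝ) * (2 : ℝ) ^ (1 / 4 : ℝ) *
            Real.exp (-Real.pi / 2 * x ^ 2) * Real.exp (-(2 * Real.pi) * s ^ 2) := by
        have : Real.exp (-Real.pi * (s + x / 2) ^ 2) * Real.exp (-Real.pi * (s + x / 2 - x) ^ 2) =
            Real.exp (-Real.pi / 2 * x ^ 2) * Real.exp (-(2 * Real.pi) * s ^ 2) := by
          rw [← Real.exp_add, ← Real.exp_add]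
          ring_nf
        unfold gaussian
        linear_combination (2 : ℝ) ^ (1 / 4 : ℝ) * (2 : ℝ) ^ (1 / 4 : ℝ) * this
      have e2 : Complex.exp (-2 * Real.pi * Complex.I * ξ * ((s + x / 2 : ℝ) : ℂ)) =
          Complex.exp (-Real.pi * Complex.I * ξ * x) *
            Complex.exp (-2 * Real.pi * Complex.I * ξ * s) := by
        rw [← Complex.exp_add]
        push_cast
        ring_nf
      rw [← Complex.ofReal_mul, e1, e2, hK, Complex.ofReal_mul]
      ring
    have hp : (starRingEnd ℂ) (p.eval ((s + x / 2 - x : ℝ) : ℂ)) =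
        ∑ j ∈ Finset.range (p.natDegree + 1),
          (starRingEnd ℂ) (p.coeff j) * ((s : ℂ) - x / 2) ^ j := by
      rw [eval_eq_sum_range, map_sum]
      refine Finset.sum_congr rfl fun j _ => ?_
      rw [map_mul, map_pow, Complex.conj_ofReal]
      congr 2
      push_cast
      ring
    have hq : q.eval ((s + x / 2 : ℝ) : ℂ) =
        ∑ i ∈ Finset.range (q.natDegree + 1), q.coeff i * ((s : ℂ) + x / 2) ^ i := by
      rw [eval_eq_sum_range]
      push_cast
      rfl
    have hs : q.eval ((s + x / 2 : ℝ) : ℂ) * (starRingEnd ℂ) (p.eval ((s + x / 2 - x : ℝ) : ℂ)) *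
        ((Real.exp (-(2 * Real.pi) * s ^ 2) : ℂ) *
            Complex.exp (-2 * Real.pi * Complex.I * ξ * s)) =
        ∑ i ∈ Finset.range (q.natDegree + 1), ∑ j ∈ Finset.range (p.natDegree + 1),
        q.coeff i * (starRingEnd ℂ) (p.coeff j) *
        (((s : ℂ) + x / 2) ^ i * ((s : ℂ) - x / 2) ^ j *
          ((Real.exp (-(2 * Real.pi) * s ^ 2) : ℂ) *
            Complex.exp (-2 * Real.pi * Complex.I * ξ * s))) := by
      rw [hp, hq, Finset.sum_mul_sum, Finset.sum_mul]
      refine Finset.sum_congr rfl fun i _ => ?_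
      rw [Finset.sum_mul]
      refine Finset.sum_congr rfl fun j _ => ?_
      ring
    rw [← hs, polyGaussian, polyGaussian, map_mul, Complex.conj_ofReal]
    linear_combination q.eval ((s + x / 2 : ℝ) : ℂ) *
      (starRingEnd ℂ) (p.eval ((s + x / 2 - x : ℝ) : ℂ)) * hg
  rw [stft, ← integral_add_right_eq_self _ (x / 2)]
  simp only [hker]
  rw [integral_const_mul, integral_finsetSum _ fun i _ => integrable_finsetSum _ fun j _ =>
    (integrable_bimonomial i j x ξ).const_mul _, Complex.ofReal_mul,
    mul_right_comm _ (Complex.ofReal (Real.exp _)) _, ← hK, mul_assoc K, stftFactor,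
    Finset.mul_sum (Finset.range (q.natDegree + 1)) _ (Complex.ofReal (Real.exp _))]
  congr 1
  refine Finset.sum_congr rfl fun i _ => ?_
  rw [integral_finsetSum _ fun j _ => (integrable_bimonomial i j x ξ).const_mul _, Finset.mul_sum]
  refine Finset.sum_congr rfl fun j _ => ?_
  rw [integral_const_mul, integral_bimonomial]
  ring

theorem stft_zero_window (f : ℝ → ℂ) (x ξ : ℝ) : stft (polyGaussian 0) f x ξ = 0 := by
  simp [stft, polyGaussian]

theorem stft_zero_signal (g : ℝ → ℂ) (x ξ : ℝ) : stft g (polyGaussian 0) x ξ = 0 := by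
  simp [stft, polyGaussian]

theorem degree_eq_of_stft_ne_zero (p q : ℂ[X])
    (h : ∀ x ξ : ℝ, stft (polyGaussian p) (polyGaussian q) x ξ ≠ 0) : p.degree = q.degree := by
  have hp : p ≠ 0 := fun hp => h 0 0 (hp ▸ stft_zero_window _ _ _)
  have hq : q ≠ 0 := fun hq => h 0 0 (hq ▸ stft_zero_signal _ _ _)
  have hF (z : ℂ) : stftFactor p q z ≠ 0 := fun hz => h z.re z.im (by
    rw [stft_polyGaussian_eq, Complex.eta, hz, mul_zero])
  have hc : q.leadingCoeff * (starRingEnd ℂ) p.leadingCoeff *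
      (1 / (2 : ℂ) ^ (1 / 2 : ℂ) * (1 / 2) ^ q.natDegree * (-1 / 2) ^ p.natDegree) ≠ 0 := by
    simp [hp, hq]
  rw [degree_eq_natDegree hp, degree_eq_natDegree hq,
    eq_of_isLittleO_sub_monomial (continuous_stftFactor p q) hF hc (stftFactor_isLittleO p q)]

/-! ### Hermite functions -/

theorem rawHermite_eq (j : ℕ) (t : ℝ) :
    rawHermite j t = (gaussPoly (2 * Real.pi) j).eval t * Real.exp (-Real.pi * t ^ 2) := by
  have h := iteratedDeriv_gaussian (2 * Real.pi) j
  simp only [← neg_mul] at h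
  rw [rawHermite, h, mul_left_comm, ← Real.exp_add]
  ring_nf

/-- Ensures that the normalization in `hermiteFun` is not a division by zero, which would make the
function vanish. -/
theorem integral_rawHermite_sq_pos (j : ℕ) : 0 < ∫ s : ℝ, rawHermite j s ^ 2 := by
  set P := gaussPoly (2 * Real.pi) j with hP
  have he : (fun s : ℝ => rawHermite j s ^ 2) =
      fun s => (P ^ 2).eval s * Real.exp (-(2 * Real.pi) * s ^ 2) := by
    ext s
    rw [rawHermite_eq, mul_pow, ← Real.exp_nat_mul, eval_pow, ← hP]
    push_cast
    ring_nf
  have hc : Continuous fun s : ℝ => rawHermite j s ^ 2 := by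
    rw [he]
    fun_prop
  have hi : Integrable fun s : ℝ => rawHermite j s ^ 2 := by
    rw [he]
    simp only [eval_eq_sum_range, Finset.sum_mul, mul_assoc]
    exact integrable_finsetSum _ fun i _ =>
      (integrable_pow_mul_gaussian (by positivity) i).const_mul _
  have hP0 : P ≠ 0 := by
    intro h0
    have := (gaussPoly_degree_coeff (2 * Real.pi) j).2
    rw [← hP, h0, coeff_zero] at this
    exact pow_ne_zero j (by simp [Real.pi_ne_zero]) this.symm
  obtain ⟨s, hs⟩ : ∃ s, P.eval s ≠ 0 := by
    by_contra! h
    exact hP0 (funext fun r => by simpa using h r)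
  refine integral_pos_of_integrable_nonneg_nonzero hc hi (fun s => sq_nonneg _) (x := s) ?_
  rw [rawHermite_eq]
  exact pow_ne_zero 2 (mul_ne_zero hs (Real.exp_ne_zero _))

/-- The polynomial factor of `hermiteFun j` with respect to `h₀`. -/
noncomputable def hermitePoly (j : ℕ) : ℂ[X] :=
  C (((-1) ^ j / Real.sqrt (∫ s : ℝ, rawHermite j s ^ 2) / (2 : ℝ) ^ (1 / 4 : ℝ) : ℝ) : ℂ) *
    (gaussPoly (2 * Real.pi) j).map (algebraMap ℝ ℂ)

theorem polyGaussian_hermitePoly (j : ℕ) (t : ℝ) :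
    polyGaussian (hermitePoly j) t = hermiteFun j t := by
  have h6 : (aeval (t : ℂ)) (gaussPoly (2 * Real.pi) j)
      = (((gaussPoly (2 * Real.pi) j).eval t : ℝ) : ℂ) := by
    simpa using (aeval_algebraMap_apply ℂ t (gaussPoly (2 * Real.pi) j))
  rw [polyGaussian, hermitePoly, eval_mul, eval_C, eval_map_algebraMap, h6, hermiteFun,
    rawHermite_eq, gaussian, ← Complex.ofReal_mul, ← Complex.ofReal_mul]
  congr 1
  have : (2 : ℝ) ^ (1 / 4 : ℝ) ≠ 0 := by positivity
  field_simp

theorem natDegree_hermitePoly_le (j : ℕ) : (hermitePoly j).natDegree ≤ j :=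
  (natDegree_C_mul_le _ _).trans (natDegree_map_le.trans (gaussPoly_degree_coeff _ j).1)

theorem coeff_hermitePoly_ne_zero (j : ℕ) : (hermitePoly j).coeff j ≠ 0 := by
  have h := integral_rawHermite_sq_pos j
  have h2 : (0 : ℝ) < (2 : ℝ) ^ (1 / 4 : ℝ) := by positivity
  have h1 : (-1) ^ j / Real.sqrt (∫ s : ℝ, rawHermite j s ^ 2) / (2 : ℝ) ^ (1 / 4 : ℝ) ≠ 0 :=
    div_ne_zero (div_ne_zero (by simp) (Real.sqrt_pos.2 h).ne') h2.ne'
  rw [hermitePoly, coeff_C_mul, coeff_map, (gaussPoly_degree_coeff _ j).2]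
  exact mul_ne_zero (Complex.ofReal_ne_zero.2 h1) (by simp [Real.pi_ne_zero])

theorem hermiteSum_eq_polyGaussian (N : ℕ) (c : ℕ → ℂ) :
    hermiteSum N c = polyGaussian (∑ j ∈ Finset.range (N + 1), C (c j) * hermitePoly j) := by
  ext t
  simp only [hermiteSum, ← polyGaussian_hermitePoly, polyGaussian, eval_finsetSum, Finset.sum_mul,
    eval_mul, eval_C, mul_assoc]

/-- Only the last summand reaches degree `N`, so nothing can cancel its leading term. -/
theorem natDegree_hermiteSum {N : ℕ} {c : ℕ → ℂ} (hc : c N ≠ 0) :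
    (∑ j ∈ Finset.range (N + 1), C (c j) * hermitePoly j).natDegree = N := by
  have hd (j : ℕ) : (C (c j) * hermitePoly j).natDegree ≤ j :=
    (natDegree_C_mul_le _ _).trans (natDegree_hermitePoly_le j)
  refine natDegree_eq_of_le_of_coeff_ne_zero (natDegree_sum_le_of_forall_le _ _ fun j hj =>
    (hd j).trans (Nat.lt_succ_iff.1 (Finset.mem_range.1 hj))) ?_
  rw [finsetSum_coeff, Finset.sum_range_succ, Finset.sum_eq_zero fun j hj =>
    coeff_eq_zero_of_natDegree_lt ((hd j).trans_lt (Finset.mem_range.1 hj)), zero_add, coeff_C_mul]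
  exact mul_ne_zero hc (coeff_hermitePoly_ne_zero N)

end HermiteSTFT

theorem mainTheorem6 :
    (∀ p q : Polynomial ℂ,
      (∀ x ξ : ℝ,
        HermiteSTFT.stft (HermiteSTFT.polyGaussian p) (HermiteSTFT.polyGaussian q) x ξ ≠ 0) →
      p.degree = q.degree) ∧
    (∀ (M N : ℕ) (a b : ℕ → ℂ), a M ≠ 0 → b N ≠ 0 → M ≠ N →
      ∃ x ξ : ℝ,
        HermiteSTFT.stft (HermiteSTFT.hermiteSum N b) (HermiteSTFT.hermiteSum M a) x ξ = 0) := by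
  refine ⟨HermiteSTFT.degree_eq_of_stft_ne_zero, fun M N a b ha hb hMN => ?_⟩
  by_contra! h
  simp only [HermiteSTFT.hermiteSum_eq_polyGaussian] at h
  have := natDegree_eq_of_degree_eq (HermiteSTFT.degree_eq_of_stft_ne_zero _ _ h)
  rw [HermiteSTFT.natDegree_hermiteSum ha, HermiteSTFT.natDegree_hermiteSum hb] at this
  exact hMN this.symm
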